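/- **Theorem (Universality of the echo state family).** Let $d,m\in\mathbb{N}$, let $\mathbb{Z}_-=\{\ldots,-2,-1,0\}$, and for $M>0$ let $K_M\subset(\mathbb{R}^d)^{\mathbb{Z}_-}$ denote the set of sequences all of whose entries lie in the closed Euclidean ball of radius $M$ centred at $\mathbf 0\in\mathbb{R}^d$, endowed with the product topology; for $L>0$ let $K_L\subset(\mathbb{R}^m)^{\mathbb{Z}_-}$ be defined in the same way with $\mathbb{R}^m$ in place of $\mathbb{R}^d$. A filter is a map $U$ from $K_M$ to $K_L$ or to $(\mathbb{R}^m)^{\mathbb{Z}_-}$. It is *causal* if $U(\mathbf z)_t=U(\mathbf w)_t$ whenever $\mathbf z_s=\mathbf w_s$ for all $s\le t$; it is *time-invariant* if it commutes with the delays $(T_k\mathbf z)_t=\mathbf z_{t-k}$, $k\in\mathbb{N}$; and it has the *fading memory property* if it is continuous with respect to the product topologies on its domain and its target. For maps $F:K_M\to(\mathbb{R}^m)^{\mathbb{Z}_-}$ put $|||F|||_\infty=\sup_{\mathbf z\in K_M}\sup_{t\in\mathbb{Z}_-}\|F(\mathbf z)_t\|\in[0,\infty]$, with $\|\cdot\|$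 the Euclidean norm. Let $\sigma:\mathbb{R}\to\mathbb{R}$. An *echo state network* with activation function $\sigma$ is a system $$\mathbf x_t=\boldsymbol\sigma(A\mathbf x_{t-1}+C\mathbf z_t+\boldsymbol\zeta),\qquad \mathbf y_t=W\mathbf x_t,\qquad t\in\mathbb{Z}_-,$$ given by an integer $N\ge 1$, matrices $A\in\mathbb{R}^{N\times N}$, $C\in\mathbb{R}^{N\times d}$, $W\in\mathbb{R}^{m\times N}$ and a vector $\boldsymbol\zeta\in\mathbb{R}^N$, where $\boldsymbol\sigma$ applies $\sigma$ componentwise. It has the *echo state property* (for inputs in $K_M$) if for every $\mathbf z\in K_M$ there is exactly one sequence $\mathbf x\in(\mathbb{R}^N)^{\mathbb{Z}_-}$ that satisfies the first equation for all $t\in\mathbb{Z}_-$. In that case its associated filter is $U_{\mathrm{ESN}}:K_M\to(\mathbb{R}^m)^{\mathbb{Z}_-}$, $U_{\mathrm{ESN}}(\mathbf z)_t=W\mathbf x_t$, and the network is said to have the fading memory property if $U_{\mathrm{ESN}}$ has it. Let $M,L>0$, let $U:K_M\to K_L$ be a causal and time-invariant filter that has the fading memory property, and let $\sigma:\mathbb{R}\to\mathbb{R}$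 be Lipschitz-continuous, bounded and non-constant. Then for every $\varepsilon>0$ there exists an echo state network with activation function $\sigma$ that has the echo state property and the fading memory property and whose associated filter $U_{\mathrm{ESN}}$ satisfies $$|||U-U_{\mathrm{ESN}}|||_\infty<\varepsilon.$$ -/

import Mathlib

open scoped ENNReal

namespace EchoState

/-- The set `ℤ₋ = {…, -2, -1, 0}` of non-positive times. -/
abbrev NegTime : Type := {t : ℤ // t ≤ 0}

/-- The time `t - k`, for `t ∈ ℤ₋` and `k ∈ ℕ`. -/
def NegTime.back (t : NegTime) (k : ℕ) : NegTime :=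
  ⟨(t : ℤ) - (k : ℤ), by have := t.2; omega⟩

/-- `K_M`: the semi-infinite sequences with values in the closed Euclidean ball of radius `M`
centred at the origin of `ℝ^d`. As a function type into a subtype it carries the product
topology of `ℤ₋` copies of that ball. -/
abbrev BoundedSeq (d : ℕ) (M : ℝ) : Type :=
  NegTime → Metric.closedBall (0 : EuclideanSpace ℝ (Fin d)) M

/-- The time delay operator: `(T_k z)_t = z_{t-k}`. -/
def delay {X : Type*} (k : ℕ) (z : NegTime → X) : NegTime → X :=
  fun t => z (t.back k)

/-- Causality: the output at time `t` depends only on the inputs up to time `t`. -/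
def IsCausal {X Y : Type*} (U : (NegTime → X) → (NegTime → Y)) : Prop :=
  ∀ (z w : NegTime → X) (t : NegTime), (∀ s, s ≤ t → z s = w s) → U z t = U w t

/-- Time invariance: the filter commutes with all time delay operators. -/
def IsTimeInvariant {X Y : Type*} (U : (NegTime → X) → (NegTime → Y)) : Prop :=
  ∀ (k : ℕ) (z : NegTime → X), U (delay k z) = delay k (U z)

/-- The fading memory property of a filter with uniformly bounded inputs: continuity for the
product topologies on the sequence spaces of inputs and outputs. -/
def HasFadingMemory {X Y : Type*} [TopologicalSpace X] [TopologicalSpace Y]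
    (U : (NegTime → X) → (NegTime → Y)) : Prop :=
  Continuous U

/-- The uniform norm `|||F|||_∞ = sup_z sup_t ‖F(z)_t‖`, with values in `[0, ∞]`. -/
noncomputable def uniformNorm {d m : ℕ} {M : ℝ}
    (F : BoundedSeq d M → (NegTime → EuclideanSpace ℝ (Fin m))) : ℝ≥0∞ :=
  ⨆ (z : BoundedSeq d M) (t : NegTime), ‖F z t‖ₑ

/-- The data of an echo state network with inputs in `ℝ^d`, states in `ℝ^N`, outputs in `ℝ^m`. -/
structure Network (d m : ℕ) where
  /-- the number of neurons -/
  N : ℕ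
  N_pos : 0 < N
  /-- the reservoir matrix -/
  A : Matrix (Fin N) (Fin N) ℝ
  /-- the input matrix -/
  C : Matrix (Fin N) (Fin d) ℝ
  /-- the input shift -/
  ζ : Fin N → ℝ
  /-- the readout matrix -/
  W : Matrix (Fin m) (Fin N) ℝ

namespace Network

variable {d m : ℕ}

/-- The state equation `x_t = σ(A x_{t-1} + C z_t + ζ)` for all `t ∈ ℤ₋`, with the activation
function `σ` applied componentwise. -/
def IsStateSolution (E : Network d m) (σ : ℝ → ℝ) {M : ℝ} (z : BoundedSeq d M)
    (x : NegTime → (Fin E.N → ℝ)) : Prop :=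
  ∀ (t : NegTime) (i : Fin E.N),
    x t i = σ ((E.A.mulVec (x (t.back 1))
      + E.C.mulVec (z t : EuclideanSpace ℝ (Fin d)).ofLp + E.ζ) i)

/-- The echo state property: every input sequence in `K_M` has exactly one solution of the state
equation (and hence exactly one output sequence). -/
def HasEchoState (E : Network d m) (σ : ℝ → ℝ) (M : ℝ) : Prop :=
  ∀ z : BoundedSeq d M, ∃! x : NegTime → (Fin E.N → ℝ), E.IsStateSolution σ z x

/-- The filter `U_ESN : K_M → (ℝ^m)^{ℤ₋}` of a network with the echo state property: it maps
`z` to `y_t = W x_t`, where `x` is the unique solution of the state equation for `z`. -/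
noncomputable def filter (E : Network d m) {σ : ℝ → ℝ} {M : ℝ} (h : E.HasEchoState σ M) :
    BoundedSeq d M → (NegTime → EuclideanSpace ℝ (Fin m)) :=
  fun z t => WithLp.toLp 2 (E.W.mulVec ((h z).choose t))

end Network

end EchoState

/-! By time invariance U(z)_t is the functional H(z) = U(z)_0 evaluated at z delayed by -t, so it
suffices to approximate the coordinates of H, continuous on the compact space K_M, uniformly by
network readouts.

The networks are feedforward: each neuron listens only to neurons further down a list. The reservoir
matrix is then strictly triangular, and the echo state property holds without any contraction
condition.

For density, let V be the closure of the linear readouts and A the closure of the admissible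
preactivations, so σ maps A into V. A mollification of σ is smooth, bounded and non-constant, hence
no polynomial, and its Taylor expansions put every power of ℓ ∈ A into V
(`pow_mem_of_activation_comp_mem`). First powers let neurons relay signals, so A contains all past
input coordinates and separates points. All powers together give exp ℓ ∈ V, and Stone–Weierstrass
yields V = C(K_M). -/

namespace EchoState

open MeasureTheory Filter Topology

/-! ### Universal approximation on a compact space -/

section Ridge

/-- Bochner integrals of functions with values in a closed subspace stay in the subspace. -/
theorem integral_mem_of_isClosed {α E : Type*} [MeasurableSpace α] {μ : Measure α}
    [NormedAddCommGroup E] [NormedSpace ℝ E] [CompleteSpace E] {V : Submodule ℝ E}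
    (hV : IsClosed (V : Set E)) {f : α → E} (hf : Integrable f μ) (hfV : ∀ a, f a ∈ V) :
    ∫ a, f a ∂μ ∈ V := by
  by_contra hx
  obtain ⟨g, u, hgV, hgx⟩ := geometric_hahn_banach_closed_point V.convex hV hx
  have hg0 : ∀ v ∈ V, g v = 0 := by
    intro v hv
    by_contra hne
    -- This multiple of v has g-value exactly u, against the strict bound.
    have := hgV _ (V.smul_mem (u / g v) hv)
    simp [hne] at this
  have h0 : g (∫ a, f a ∂μ) = 0 := by
    rw [← ContinuousLinearMap.integral_comp_comm g hf]
    simp [hg0 _ (hfV _)]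
  have := hgV 0 V.zero_mem
  rw [map_zero] at this
  linarith

variable {K : Type*} [TopologicalSpace K] [CompactSpace K]

/-- A closed subspace containing all `σ ∘ (ℓ - t)` contains the composition of `ℓ` with the
mollification of `σ`. -/
theorem convolution_comp_mem {V : Submodule ℝ C(K, ℝ)} (hV : IsClosed (V : Set C(K, ℝ)))
    {φ : ℝ → ℝ} (hφ : Continuous φ) (hφc : HasCompactSupport φ) {σ : C(ℝ, ℝ)} {ℓ g : C(K, ℝ)}
    (hσ : ∀ t : ℝ, σ.comp (ℓ - ContinuousMap.const K t) ∈ V)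
    (hg : ∀ x, g x = convolution φ σ (ContinuousLinearMap.lsmul ℝ ℝ) volume (ℓ x)) :
    g ∈ V := by
  have hcont : Continuous fun t : ℝ => φ t • σ.comp (ℓ - ContinuousMap.const K t) := by
    refine hφ.smul (ContinuousMap.continuous_of_continuous_uncurry _ ?_)
    change Continuous fun p : ℝ × K => σ (ℓ p.2 - p.1)
    fun_prop
  have hint : Integrable (fun t : ℝ => φ t • σ.comp (ℓ - ContinuousMap.const K t)) :=
    hcont.integrable_of_hasCompactSupport hφc.smul_right
  have hgeq : g = ∫ t, φ t • σ.comp (ℓ - ContinuousMap.const K t) := by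
    ext x
    rw [ContinuousMap.integral_apply hint, hg]
    rfl
  rw [hgeq]
  exact integral_mem_of_isClosed hV hint fun t => V.smul_mem _ (hσ t)

/-- A bounded non-constant continuous function has a bounded non-constant smooth mollification. -/
theorem exists_mollification {σ : ℝ → ℝ} (hσ : Continuous σ) (hbdd : ∃ B : ℝ, ∀ x, |σ x| ≤ B)
    (hnc : ∃ x y, σ x ≠ σ y) :
    ∃ φ : ℝ → ℝ, Continuous φ ∧ HasCompactSupport φ ∧
      ContDiff ℝ (⊤ : ℕ∞) (convolution φ σ (ContinuousLinearMap.lsmul ℝ ℝ) volume) ∧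
      (∃ B : ℝ, ∀ x, |convolution φ σ (ContinuousLinearMap.lsmul ℝ ℝ) volume x| ≤ B) ∧
      ∃ x y, convolution φ σ (ContinuousLinearMap.lsmul ℝ ℝ) volume x
        ≠ convolution φ σ (ContinuousLinearMap.lsmul ℝ ℝ) volume y := by
  obtain ⟨B, hB⟩ := hbdd
  obtain ⟨x, y, hxy⟩ := hnc
  let ψ : ℕ → ContDiffBump (0 : ℝ) := fun n =>
    ⟨1 / (2 * ((n : ℝ) + 1)), 1 / ((n : ℝ) + 1), by positivity, by
      apply one_div_lt_one_div_of_lt <;> [positivity; skip]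
      have : (0 : ℝ) ≤ n := n.cast_nonneg
      linarith⟩
  have hψ : Tendsto (fun n => (ψ n).rOut) atTop (𝓝 0) := tendsto_one_div_add_atTop_nhds_zero_nat
  have hx := ContDiffBump.convolution_tendsto_right_of_continuous (μ := volume) hψ hσ x
  have hy := ContDiffBump.convolution_tendsto_right_of_continuous (μ := volume) hψ hσ y
  -- Mollifications converge pointwise, so a narrow enough one still separates x and y.
  obtain ⟨n, hn⟩ := ((hx.sub hy).eventually_ne (sub_ne_zero.mpr hxy)).exists
  refine ⟨(ψ n).normed volume, (ψ n).continuous_normed, (ψ n).hasCompactSupport_normed, ?_,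
    ⟨B + 2 * B, fun z => ?_⟩, x, y, sub_ne_zero.mp hn⟩
  · exact HasCompactSupport.contDiff_convolution_left _ (ψ n).hasCompactSupport_normed
      (ψ n).contDiff_normed hσ.locallyIntegrable
  · have := ContDiffBump.dist_normed_convolution_le (φ := ψ n) (μ := volume) (x₀ := z) (ε := 2 * B)
      hσ.aestronglyMeasurable (fun w _ => by
        rw [Real.dist_eq]
        have := abs_sub (σ w) (σ z)
        linarith [hB w, hB z])
    rw [Real.dist_eq] at this
    have h2 := abs_sub_abs_le_abs_sub
      (convolution ((ψ n).normed volume) σ (ContinuousLinearMap.lsmul ℝ ℝ) volume z) (σ z)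
    linarith [hB z]

/-- No derivative of a bounded non-constant smooth function vanishes identically. -/
theorem exists_iteratedDeriv_ne_zero {f : ℝ → ℝ} (hf : ContDiff ℝ (⊤ : ℕ∞) f)
    (hbdd : ∃ B : ℝ, ∀ x, |f x| ≤ B) (hnc : ∃ x y, f x ≠ f y) (n : ℕ) :
    ∃ b, iteratedDeriv n f b ≠ 0 := by
  by_contra! h
  -- If the n-th derivative vanishes, the Lagrange remainder does too and f is a polynomial; bounded
  -- polynomials are constant.
  have hpoly : ∃ p : Polynomial ℝ, ∀ x, f x = p.eval x := by
    rcases n with _ | n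
    · exact ⟨0, fun x => by simpa using h x⟩
    refine ⟨∑ k ∈ Finset.range (n + 1),
      Polynomial.C (iteratedDeriv k f 0 / k.factorial) * Polynomial.X ^ k, fun x => ?_⟩
    have htaylor : f x = taylorWithinEval f n Set.univ 0 x := by
      rcases eq_or_ne x 0 with rfl | hx
      · rw [taylorWithinEval_self]
      obtain ⟨y, -, hy⟩ := taylor_mean_remainder_lagrange_iteratedDeriv (n := n) hx.symm
        (hf.of_le (by exact_mod_cast le_top)).contDiffOn
      rw [h y, zero_mul, zero_div, sub_eq_zero] at hy
      rw [hy, taylor_within_apply, taylor_within_apply]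
      refine Finset.sum_congr rfl fun k _ => ?_
      rw [iteratedDerivWithin_univ, iteratedDerivWithin_eq_iteratedDeriv
        (uniqueDiffOn_uIcc hx.symm) (hf.of_le (by exact_mod_cast le_top)).contDiffAt
        Set.left_mem_uIcc]
    rw [htaylor, taylor_within_apply, Polynomial.eval_finsetSum]
    refine Finset.sum_congr rfl fun k _ => ?_
    simp only [iteratedDerivWithin_univ, sub_zero, smul_eq_mul, Polynomial.eval_mul,
      Polynomial.eval_C, Polynomial.eval_pow, Polynomial.eval_X]
    ring
  obtain ⟨p, hp⟩ := hpoly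
  obtain ⟨B, hB⟩ := hbdd
  obtain ⟨x, y, hxy⟩ := hnc
  have hdeg := (Polynomial.isBoundedUnder_abs_atTop_iff p).mp
    ⟨B, by simpa using ⟨0, fun x _ => hp x ▸ hB x⟩⟩
  rw [Polynomial.eq_C_of_degree_le_zero hdeg] at hp
  exact hxy (by simp [hp])

/-- If a closed subspace `V` contains all `f ∘ (b + a ℓ)` for a smooth `f` none of whose
derivatives vanishes identically, then it contains all powers of `ℓ`. -/
theorem pow_mem_of_forall_comp_mem {V : Submodule ℝ C(K, ℝ)} (hV : IsClosed (V : Set C(K, ℝ)))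
    {f : C(ℝ, ℝ)} (hf : ContDiff ℝ (⊤ : ℕ∞) f) (hne : ∀ n, ∃ b, iteratedDeriv n f b ≠ 0)
    {ℓ : C(K, ℝ)} (hfℓ : ∀ a b : ℝ, f.comp (ContinuousMap.const K b + a • ℓ) ∈ V) (n : ℕ) :
    ℓ ^ n ∈ V := by
  induction n using Nat.strong_induction_on with
  | _ n ih =>
    obtain ⟨b, hb⟩ := hne n
    set c : ℕ → ℝ := fun k => (k.factorial : ℝ)⁻¹ * iteratedDeriv k f b with hc
    have hcn : c n ≠ 0 := mul_ne_zero (by positivity) hb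
    suffices h : c n • ℓ ^ n ∈ V by
      simpa [smul_smul, hcn] using V.smul_mem (c n)⁻¹ h
    rw [← SetLike.mem_coe, ← hV.closure_eq, Metric.mem_closure_iff]
    intro ε hε
    have ho := taylor_isLittleO_univ (x₀ := b) (n := n) (hf.of_le (by exact_mod_cast le_top))
    set η : ℝ := ε / (2 * (‖ℓ‖ ^ n + 1)) with hη
    have hη0 : 0 < η := by positivity
    obtain ⟨δ, hδ, hδf⟩ := Metric.eventually_nhds_iff.mp (ho.def hη0)
    set a : ℝ := δ / (2 * (‖ℓ‖ + 1)) with ha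
    have ha0 : 0 < a := by positivity
    -- Remove from f(b + aℓ) the Taylor terms below n, in V by induction, and rescale: c n • ℓ ^ n
    -- remains up to o(a^n)/a^n.
    refine ⟨(a ^ n)⁻¹ • (f.comp (ContinuousMap.const K b + a • ℓ)
      - ∑ k ∈ Finset.range n, (c k * a ^ k) • ℓ ^ k), ?_, ?_⟩
    · exact V.smul_mem _ (V.sub_mem (hfℓ a b)
        (V.sum_mem fun k hk => V.smul_mem _ (ih k (Finset.mem_range.mp hk))))
    rw [dist_comm]
    refine lt_of_le_of_lt ((ContinuousMap.dist_le (C := ε / 2) (by positivity)).mpr fun x => ?_)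
      (half_lt_self hε)
    have hℓx : |ℓ x| ≤ ‖ℓ‖ := ℓ.norm_coe_le_norm x
    have hsmall : dist (b + a * ℓ x) b < δ := by
      rw [Real.dist_eq, add_sub_cancel_left, abs_mul, abs_of_pos ha0]
      calc a * |ℓ x| ≤ a * (‖ℓ‖ + 1) := by gcongr; linarith
        _ = δ / 2 := by rw [ha]; field_simp
        _ < δ := half_lt_self hδ
    have hmain := hδf hsmall
    rw [taylor_within_apply, Finset.sum_range_succ] at hmain
    simp only [iteratedDerivWithin_univ, add_sub_cancel_left, Real.norm_eq_abs, smul_eq_mul]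
      at hmain
    rw [Real.dist_eq]
    have hexpr : ((a ^ n)⁻¹ • (f.comp (ContinuousMap.const K b + a • ℓ)
        - ∑ k ∈ Finset.range n, (c k * a ^ k) • ℓ ^ k)) x - (c n • ℓ ^ n) x =
        (a ^ n)⁻¹ * (f (b + a * ℓ x) - (∑ k ∈ Finset.range n,
          ((k.factorial : ℝ)⁻¹ * (a * ℓ x) ^ k) * iteratedDeriv k f b +
          ((n.factorial : ℝ)⁻¹ * (a * ℓ x) ^ n) * iteratedDeriv n f b)) := by
      have hsum : (∑ k ∈ Finset.range n, (c k * a ^ k) • ℓ ^ k) x =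
          ∑ k ∈ Finset.range n,
            ((k.factorial : ℝ)⁻¹ * (a * ℓ x) ^ k) * iteratedDeriv k f b := by
        rw [ContinuousMap.sum_apply]
        refine Finset.sum_congr rfl fun k _ => ?_
        simp only [ContinuousMap.smul_apply, ContinuousMap.pow_apply, smul_eq_mul, hc]
        ring
      rw [ContinuousMap.smul_apply, ContinuousMap.sub_apply, hsum]
      simp only [ContinuousMap.smul_apply, ContinuousMap.comp_apply, ContinuousMap.add_apply,
        ContinuousMap.const_apply, ContinuousMap.pow_apply, smul_eq_mul, hc]
      rw [mul_pow _ _ n]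
      field_simp
      ring
    rw [hexpr, abs_mul, abs_inv, abs_of_pos (pow_pos ha0 n)]
    calc (a ^ n)⁻¹ * _ ≤ (a ^ n)⁻¹ * (η * |(a * ℓ x) ^ n|) := by gcongr
      _ = η * |ℓ x| ^ n := by
        rw [abs_pow, abs_mul, abs_of_pos ha0, mul_pow]
        field_simp
      _ ≤ η * (‖ℓ‖ ^ n + 1) := by
        gcongr
        exact (pow_le_pow_left₀ (abs_nonneg _) hℓx n).trans (by linarith)
      _ = ε / 2 := by rw [hη]; field_simp

/-- If a closed subspace `V` contains all `σ ∘ ℓ`, for `ℓ` in a subspace `A` containing the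
constants, then it contains all powers of elements of `A`. -/
theorem pow_mem_of_activation_comp_mem {V A : Submodule ℝ C(K, ℝ)}
    (hV : IsClosed (V : Set C(K, ℝ))) (hA : (1 : C(K, ℝ)) ∈ A) {σ : C(ℝ, ℝ)}
    (hbdd : ∃ B : ℝ, ∀ x, |σ x| ≤ B) (hnc : ∃ x y, σ x ≠ σ y) (hσ : ∀ ℓ ∈ A, σ.comp ℓ ∈ V)
    {ℓ : C(K, ℝ)} (hℓ : ℓ ∈ A) (n : ℕ) : ℓ ^ n ∈ V := by
  have hconst : ∀ b : ℝ, ContinuousMap.const K b ∈ A := fun b => by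
    convert A.smul_mem b hA
    ext x
    simp
  obtain ⟨φ, hφ, hφc, hsmooth, hfb, hfnc⟩ := exists_mollification σ.continuous hbdd hnc
  refine pow_mem_of_forall_comp_mem hV (f := ⟨_, hsmooth.continuous⟩) hsmooth
    (exists_iteratedDeriv_ne_zero hsmooth hfb hfnc) (fun a b => ?_) n
  exact convolution_comp_mem hV hφ hφc
    (fun t => hσ _ (A.sub_mem (A.add_mem (hconst b) (A.smul_mem a hℓ)) (hconst t))) fun x => rfl

/-- **Universal approximation**: a closed subspace of `C(K, ℝ)` containing all `σ ∘ ℓ`, for `ℓ` in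
a point-separating subspace `A` containing the constants, is everything. -/
theorem eq_top_of_activation_comp_mem {V A : Submodule ℝ C(K, ℝ)}
    (hV : IsClosed (V : Set C(K, ℝ))) (hA : (1 : C(K, ℝ)) ∈ A)
    (hsep : ∀ x y : K, x ≠ y → ∃ ℓ ∈ A, ℓ x ≠ ℓ y) {σ : C(ℝ, ℝ)}
    (hbdd : ∃ B : ℝ, ∀ x, |σ x| ≤ B) (hnc : ∃ x y, σ x ≠ σ y) (hσ : ∀ ℓ ∈ A, σ.comp ℓ ∈ V) :
    V = ⊤ := by
  have hexp : ∀ ℓ ∈ A, NormedSpace.exp ℓ ∈ V := fun ℓ hℓ =>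
    hV.mem_of_tendsto (NormedSpace.exp_series_hasSum_exp' (𝕂 := ℝ) ℓ)
      (Eventually.of_forall fun s => V.sum_mem fun n _ =>
        V.smul_mem _ (pow_mem_of_activation_comp_mem hV hA hbdd hnc hσ hℓ n))
  -- Since exp turns sums into products, exp(A) is multiplicatively closed and the algebra it
  -- generates is just its span.
  let S : Submonoid C(K, ℝ) :=
    { carrier := NormedSpace.exp '' (A : Set C(K, ℝ))
      one_mem' := ⟨0, A.zero_mem, NormedSpace.exp_zero⟩
      mul_mem' := by
        rintro _ _ ⟨f, hf, rfl⟩ ⟨g, hg, rfl⟩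
        exact ⟨f + g, A.add_mem hf hg, NormedSpace.exp_add⟩ }
  have hS : Subalgebra.toSubmodule (Algebra.adjoin ℝ (S : Set C(K, ℝ))) ≤ V := by
    rw [Algebra.adjoin_eq_span, Submonoid.closure_eq, Submodule.span_le]
    rintro _ ⟨ℓ, hℓ, rfl⟩
    exact hexp ℓ hℓ
  have happly : ∀ (ℓ : C(K, ℝ)) (x : K), NormedSpace.exp ℓ x = Real.exp (ℓ x) := by
    intro ℓ x
    rw [Real.exp_eq_exp_ℝ]
    exact NormedSpace.map_exp (ContinuousMap.evalAlgHom ℝ ℝ x)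
      (continuous_eval_const x) ℓ
  have htop := ContinuousMap.subalgebra_topologicalClosure_eq_top_of_separatesPoints
    (Algebra.adjoin ℝ (S : Set C(K, ℝ))) (by
      intro x y hxy
      obtain ⟨ℓ, hℓ, hne⟩ := hsep x y hxy
      refine ⟨_, ⟨NormedSpace.exp ℓ, Algebra.subset_adjoin ⟨ℓ, hℓ, rfl⟩, rfl⟩, ?_⟩
      simpa [happly] using hne)
  refine eq_top_iff.mpr fun f _ => ?_
  have hf : f ∈ (Algebra.adjoin ℝ (S : Set C(K, ℝ))).topologicalClosure := htop ▸ trivial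
  exact hV.closure_subset_iff.mpr hS hf

end Ridge

/-! ### Time shifts and compactness -/

/-- The time `0`. -/
def NegTime.now : NegTime := ⟨0, le_rfl⟩

theorem NegTime.now_back_toNat (t : NegTime) : NegTime.now.back (-(t : ℤ)).toNat = t := by
  have := t.2
  apply Subtype.ext
  simp only [NegTime.back, NegTime.now]
  omega

theorem NegTime.back_back (t : NegTime) (j k : ℕ) : (t.back j).back k = t.back (j + k) := by
  apply Subtype.ext
  simp only [NegTime.back]
  omega

theorem delay_delay {X : Type*} (j k : ℕ) (z : NegTime → X) :
    delay j (delay k z) = delay (j + k) z := by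
  funext t
  simp only [delay, NegTime.back_back]

theorem toNat_neg_back_one (t : NegTime) :
    (-((t.back 1 : NegTime) : ℤ)).toNat = 1 + (-(t : ℤ)).toNat := by
  have := t.2
  simp only [NegTime.back]
  omega

/-- The delay operator as a continuous map. -/
def delayMap {X : Type*} [TopologicalSpace X] (k : ℕ) : C(NegTime → X, NegTime → X) :=
  ⟨delay k, continuous_pi fun t => continuous_apply (t.back k)⟩

instance compactSpace_boundedSeq (d : ℕ) (M : ℝ) : CompactSpace (BoundedSeq d M) :=
  haveI : CompactSpace (Metric.closedBall (0 : EuclideanSpace ℝ (Fin d)) M) :=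
    isCompact_iff_compactSpace.mp (isCompact_closedBall 0 M)
  inferInstance

variable {d m : ℕ} {M : ℝ}

/-! ### Feedforward neurons and density of their readouts -/

/-- The affine function `z ↦ ⟨c, z_0⟩ + b` of the input at time `0`. -/
noncomputable def affineInput (c : Fin d → ℝ) (b : ℝ) : C(BoundedSeq d M, ℝ) :=
  ⟨fun z => ∑ i, c i * (z NegTime.now : EuclideanSpace ℝ (Fin d)).ofLp i + b, by fun_prop⟩

/-- Lists of functionals, each of them the activity at time `0` of a neuron that is driven by the
present input and by the preceding activities of the neurons further down the list. -/
inductive IsNeuronList (σ : C(ℝ, ℝ)) : List C(BoundedSeq d M, ℝ) → Prop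
  | nil : IsNeuronList σ []
  | cons {L : List C(BoundedSeq d M, ℝ)} {f : C(BoundedSeq d M, ℝ)} (c : Fin d → ℝ) (b : ℝ)
      (hL : IsNeuronList σ L) (hf : f ∈ Submodule.span ℝ {g | g ∈ L}) :
      IsNeuronList σ (σ.comp (f.comp (delayMap 1) + affineInput c b) :: L)

/-- Two reservoirs run side by side: a longer tail only enlarges the span available to each neuron.
This makes readouts closed under sums. -/
theorem IsNeuronList.append {σ : C(ℝ, ℝ)} {L₁ L₂ : List C(BoundedSeq d M, ℝ)}
    (h₁ : IsNeuronList σ L₁) (h₂ : IsNeuronList σ L₂) : IsNeuronList σ (L₁ ++ L₂) := by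
  induction h₁ with
  | nil => exact h₂
  | cons c b _ hf ih =>
    exact .cons c b ih (Submodule.span_mono (fun g hg => List.mem_append_left _ hg) hf)

/-- The functionals that are linear readouts of a list of neurons. -/
def readouts (σ : C(ℝ, ℝ)) : Submodule ℝ C(BoundedSeq d M, ℝ) where
  carrier := {f | ∃ L, IsNeuronList σ L ∧ f ∈ Submodule.span ℝ {g | g ∈ L}}
  zero_mem' := ⟨[], .nil, Submodule.zero_mem _⟩
  add_mem' := by
    rintro f g ⟨L₁, h₁, hf⟩ ⟨L₂, h₂, hg⟩
    exact ⟨L₁ ++ L₂, h₁.append h₂, Submodule.add_mem _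
      (Submodule.span_mono (fun g hg => List.mem_append_left _ hg) hf)
      (Submodule.span_mono (fun g hg => List.mem_append_right _ hg) hg)⟩
  smul_mem' := by
    rintro a f ⟨L, hL, hf⟩
    exact ⟨L, hL, Submodule.smul_mem _ a hf⟩

/-- The functionals that can be fed into the activation function of a further neuron. -/
def preactivations (σ : C(ℝ, ℝ)) : Submodule ℝ C(BoundedSeq d M, ℝ) where
  carrier := {ℓ | ∃ f ∈ readouts σ, ∃ (c : Fin d → ℝ) (b : ℝ),
    ℓ = f.comp (delayMap 1) + affineInput c b}
  zero_mem' := ⟨0, Submodule.zero_mem _, 0, 0, by ext z; simp [affineInput]⟩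
  add_mem' := by
    rintro _ _ ⟨f, hf, c, b, rfl⟩ ⟨g, hg, c', b', rfl⟩
    refine ⟨f + g, Submodule.add_mem _ hf hg, c + c', b + b', ?_⟩
    ext z
    simp [affineInput, add_mul, Finset.sum_add_distrib]
    ring
  smul_mem' := by
    rintro a _ ⟨f, hf, c, b, rfl⟩
    refine ⟨a • f, Submodule.smul_mem _ a hf, a • c, a * b, ?_⟩
    ext z
    simp [affineInput, mul_add, Finset.mul_sum, mul_assoc]

theorem comp_mem_readouts {σ : C(ℝ, ℝ)} {ℓ : C(BoundedSeq d M, ℝ)} (hℓ : ℓ ∈ preactivations σ) :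
    σ.comp ℓ ∈ readouts σ := by
  obtain ⟨f, ⟨L, hL, hf⟩, c, b, rfl⟩ := hℓ
  exact ⟨_, .cons c b hL hf, Submodule.subset_span List.mem_cons_self⟩

/-- Readouts of neurons are dense in the continuous functionals of the input. -/
theorem topologicalClosure_readouts {σ : C(ℝ, ℝ)} (hbdd : ∃ B : ℝ, ∀ x, |σ x| ≤ B)
    (hnc : ∃ x y, σ x ≠ σ y) :
    (readouts σ : Submodule ℝ C(BoundedSeq d M, ℝ)).topologicalClosure = ⊤ := by
  set V := (readouts σ : Submodule ℝ C(BoundedSeq d M, ℝ)).topologicalClosure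
  set A := (preactivations σ : Submodule ℝ C(BoundedSeq d M, ℝ)).topologicalClosure
  have hV : IsClosed (V : Set C(BoundedSeq d M, ℝ)) := Submodule.isClosed_topologicalClosure _
  have hσ : ∀ ℓ ∈ A, σ.comp ℓ ∈ V := fun ℓ hℓ =>
    map_mem_closure (ContinuousMap.continuous_postcomp σ) hℓ fun _ => comp_mem_readouts
  have hin : ∀ (c : Fin d → ℝ) (b : ℝ), affineInput c b ∈ A := fun c b =>
    Submodule.le_topologicalClosure _ ⟨0, Submodule.zero_mem _, c, b, by ext; simp⟩
  have h1 : (1 : C(BoundedSeq d M, ℝ)) ∈ A := by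
    convert hin 0 1
    ext z
    simp [affineInput]
  have hdelay : ∀ f ∈ V, f.comp (delayMap 1) ∈ A := fun f hf =>
    map_mem_closure (f := fun f : C(BoundedSeq d M, ℝ) => f.comp (delayMap 1))
      (ContinuousMap.continuous_precomp (delayMap 1)) hf fun g hg =>
      ⟨g, hg, 0, 0, by ext; simp [affineInput]⟩
  have hcoord : ∀ (i : Fin d) (k : ℕ), ∃ ℓ ∈ A, ∀ z : BoundedSeq d M,
      ℓ z = (z (NegTime.now.back k) : EuclideanSpace ℝ (Fin d)).ofLp i := by
    intro i k
    induction k with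
    | zero => exact ⟨_, hin (Pi.single i 1) 0, fun z => by
        simp [affineInput, Pi.single_apply, NegTime.back, NegTime.now]⟩
    | succ k ih =>
      obtain ⟨ℓ, hℓ, hz⟩ := ih
      -- The power 1 gives A ⊆ V: ℓ is approximately relayed by neurons, and one more delay makes it
      -- a preactivation again.
      refine ⟨_, hdelay ℓ (by simpa using pow_mem_of_activation_comp_mem hV h1 hbdd hnc hσ hℓ 1),
        fun z => ?_⟩
      change ℓ (delay 1 z) = _
      rw [hz, delay, NegTime.back_back]
  refine eq_top_of_activation_comp_mem hV h1 (fun x y hxy => ?_) hbdd hnc hσ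
  obtain ⟨t, ht⟩ := Function.ne_iff.mp hxy
  obtain ⟨i, hi⟩ : ∃ i, (x t : EuclideanSpace ℝ (Fin d)).ofLp i
      ≠ (y t : EuclideanSpace ℝ (Fin d)).ofLp i := by
    by_contra! h
    exact ht (Subtype.ext (PiLp.ext h))
  obtain ⟨ℓ, hℓ, hz⟩ := hcoord i (-(t : ℤ)).toNat
  rw [NegTime.now_back_toNat] at hz
  exact ⟨ℓ, hℓ, by rwa [hz, hz]⟩

/-! ### From neuron lists to networks -/

theorem mem_span_list_iff {L : List C(BoundedSeq d M, ℝ)} {f : C(BoundedSeq d M, ℝ)} :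
    f ∈ Submodule.span ℝ {g | g ∈ L} ↔
      ∃ a : Fin L.length → ℝ, ∀ z, f z = ∑ j, a j * L.get j z := by
  rw [← Set.range_list_get, Submodule.mem_span_range_iff_exists_fun]
  refine exists_congr fun a => ?_
  rw [ContinuousMap.ext_iff]
  simp [eq_comm]

/-- A list of neurons is described by a strictly triangular reservoir matrix. -/
theorem IsNeuronList.exists_matrices {σ : C(ℝ, ℝ)} {L : List C(BoundedSeq d M, ℝ)}
    (hL : IsNeuronList σ L) :
    ∃ (A : Matrix (Fin L.length) (Fin L.length) ℝ) (C : Matrix (Fin L.length) (Fin d) ℝ)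
      (ζ : Fin L.length → ℝ), (∀ i j, j ≤ i → A i j = 0) ∧
      ∀ i z, L.get i z = σ (∑ j, A i j * L.get j (delay 1 z) +
        ∑ k, C i k * (z NegTime.now : EuclideanSpace ℝ (Fin d)).ofLp k + ζ i) := by
  induction hL with
  | nil => exact ⟨0, 0, 0, fun i => i.elim0, fun i => i.elim0⟩
  | @cons L f c b hL hf ih =>
    obtain ⟨A, C, ζ, hA, h⟩ := ih
    obtain ⟨a, ha⟩ := mem_span_list_iff.mp hf
    -- The new neuron gets index 0 and reads the old ones through a; the zero column says that
    -- nobody reads it.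
    refine ⟨Fin.cons (Fin.cons 0 a) fun i => Fin.cons 0 (A i), Fin.cons c C, Fin.cons b ζ, ?_, ?_⟩
    · intro (i : Fin (L.length + 1)) (j : Fin (L.length + 1)) hij
      induction i using Fin.cases with
      | zero =>
        obtain rfl : j = 0 := Fin.le_zero_iff.mp hij
        rfl
      | succ i =>
        induction j using Fin.cases with
        | zero => rfl
        | succ j => exact hA i j (Fin.succ_le_succ_iff.mp hij)
    · intro (i : Fin (L.length + 1)) z
      refine Eq.trans ?_ (congrArg (fun s => σ (s + _ + _)) (Fin.sum_univ_succ
        fun j : Fin (L.length + 1) =>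
          (Fin.cons (Fin.cons 0 a) fun i => Fin.cons 0 (A i) :
            Fin (L.length + 1) → Fin (L.length + 1) → ℝ) i j *
          (σ.comp (f.comp (delayMap 1) + affineInput c b) :: L).get j (delay 1 z)).symm)
      induction i using Fin.cases with
      | zero =>
        change σ (f (delay 1 z) + (_ + b)) = σ (0 * _ + ∑ j, a j * L.get j (delay 1 z) + _ + b)
        rw [ha, zero_mul, zero_add, add_assoc]
        rfl
      | succ i =>
        change L.get i z = σ (0 * _ + ∑ j, A i j * L.get j (delay 1 z) + _ + ζ i)
        rw [h, zero_mul, zero_add]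
        rfl

/-- A network with strictly triangular reservoir matrix has at most one state solution. -/
theorem Network.state_unique {E : Network d m} {σ : ℝ → ℝ} (hA : ∀ i j, j ≤ i → E.A i j = 0)
    {z : BoundedSeq d M} {x y : NegTime → (Fin E.N → ℝ)} (hx : E.IsStateSolution σ z x)
    (hy : E.IsStateSolution σ z y) : x = y := by
  have key : ∀ i : Fin E.N, ∀ t, x t i = y t i := by
    intro i
    -- Induct from the last neuron down: row i only involves j > i.
    induction i using WellFoundedGT.induction with
    | _ i ih =>
      intro t
      rw [hx t i, hy t i]
      have : E.A.mulVec (x (t.back 1)) i = E.A.mulVec (y (t.back 1)) i := by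
        simp only [Matrix.mulVec, dotProduct]
        refine Finset.sum_congr rfl fun j _ => ?_
        rcases le_or_gt j i with hj | hj
        · rw [hA i j hj, zero_mul, zero_mul]
        · rw [ih j hj]
      simp only [Pi.add_apply, this]
  funext t i
  exact key i t

theorem exists_common_neuronList {σ : C(ℝ, ℝ)} {ι : Type*} (f : ι → C(BoundedSeq d M, ℝ))
    (hf : ∀ j, f j ∈ readouts σ) (s : Finset ι) :
    ∃ L, IsNeuronList σ L ∧ L ≠ [] ∧ ∀ j ∈ s, f j ∈ Submodule.span ℝ {g | g ∈ L} := by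
  classical
  induction s using Finset.induction_on with
  -- A dummy neuron with constant value σ(0) ensures N > 0.
  | empty => exact ⟨_, .cons 0 0 .nil (Submodule.zero_mem _), List.cons_ne_nil _ _, by simp⟩
  | insert j s _ ih =>
    obtain ⟨L₁, h₁, hne, hs⟩ := ih
    obtain ⟨L₂, h₂, hj⟩ := hf j
    refine ⟨L₁ ++ L₂, h₁.append h₂, by simp [hne], fun i hi => ?_⟩
    rcases Finset.mem_insert.mp hi with rfl | hi
    · exact Submodule.span_mono (fun g hg => List.mem_append_right _ hg) hj
    · exact Submodule.span_mono (fun g hg => List.mem_append_left _ hg) (hs i hi)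

/-- Finitely many readouts are the outputs of one echo state network, whose filter is given by
them. -/
theorem exists_network_of_readouts {σ : C(ℝ, ℝ)} (f : Fin m → C(BoundedSeq d M, ℝ))
    (hf : ∀ j, f j ∈ readouts σ) :
    ∃ (E : Network d m) (hE : E.HasEchoState σ M), ∀ z t,
      E.filter hE z t = WithLp.toLp 2 fun j => f j (delay (-(t : ℤ)).toNat z) := by
  obtain ⟨L, hL, hne, hspan⟩ := exists_common_neuronList f hf Finset.univ
  obtain ⟨A, C, ζ, hA, hL⟩ := hL.exists_matrices
  choose W hW using fun j => mem_span_list_iff.mp (hspan j (Finset.mem_univ j))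
  let E : Network d m := ⟨L.length, List.length_pos_iff.mpr hne, A, C, ζ, W⟩
  -- Delaying by -t moves time t to time 0, where the functionals of the list are evaluated.
  have hsol : ∀ z : BoundedSeq d M,
      E.IsStateSolution σ z fun t i => L.get i (delay (-(t : ℤ)).toNat z) := by
    intro z t i
    change L.get i _ = _
    rw [hL i, delay_delay, ← toNat_neg_back_one]
    change _ = σ (∑ j, A i j * _ + ∑ k, C i k * _ + ζ i)
    rw [delay, NegTime.now_back_toNat]
  have hE : E.HasEchoState σ M := fun z => ⟨_, hsol z, fun y hy => E.state_unique hA hy (hsol z)⟩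
  refine ⟨E, hE, fun z t => ?_⟩
  rw [Network.filter, E.state_unique hA (hE z).choose_spec.1 (hsol z)]
  congr 1
  funext j
  exact (hW j _).symm

theorem euclidean_norm_le_sum (v : EuclideanSpace ℝ (Fin m)) : ‖v‖ ≤ ∑ j, |v.ofLp j| := by
  rw [EuclideanSpace.norm_eq]
  refine Real.sqrt_le_iff.mpr ⟨Finset.sum_nonneg fun j _ => abs_nonneg _, ?_⟩
  exact Finset.sum_sq_le_sq_sum_of_nonneg fun j _ => abs_nonneg _

end EchoState

/-! ### Approximating the filter -/

theorem mainTheorem1 (d m : ℕ) (M L : ℝ) (hM : 0 < M) (hL : 0 < L)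
    (U : EchoState.BoundedSeq d M → EchoState.BoundedSeq m L)
    (hcausal : EchoState.IsCausal U) (hti : EchoState.IsTimeInvariant U)
    (hfm : EchoState.HasFadingMemory U)
    (σ : ℝ → ℝ) (hLip : ∃ κ : NNReal, LipschitzWith κ σ)
    (hbdd : ∃ B : ℝ, ∀ x : ℝ, |σ x| ≤ B) (hnonconst : ∃ x y : ℝ, σ x ≠ σ y)
    (ε : ℝ) (hε : 0 < ε) :
    ∃ (E : EchoState.Network d m) (hE : E.HasEchoState σ M),
      EchoState.HasFadingMemory (E.filter hE) ∧
      EchoState.uniformNorm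
        (fun z t => (U z t : EuclideanSpace ℝ (Fin m)) - E.filter hE z t)
          < ENNReal.ofReal ε := by
  open EchoState in
  obtain ⟨κ, hκ⟩ := hLip
  let τ : C(ℝ, ℝ) := ⟨σ, hκ.continuous⟩
  let H : Fin m → C(BoundedSeq d M, ℝ) := fun j =>
    ⟨fun z => (U z NegTime.now : EuclideanSpace ℝ (Fin m)).ofLp j, by
      have hU : Continuous U := hfm
      fun_prop⟩
  -- The m coordinate errors add up to at most ε / 2, which keeps the supremum strictly below ε; m +
  -- 1 allows m = 0.
  have hδ : 0 < ε / (2 * ((m : ℝ) + 1)) := by positivity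
  have happrox : ∀ j, ∃ f ∈ readouts τ, dist (H j) f < ε / (2 * ((m : ℝ) + 1)) := fun j => by
    have hmem : H j ∈ (readouts τ : Submodule ℝ C(BoundedSeq d M, ℝ)).topologicalClosure := by
      rw [topologicalClosure_readouts (σ := τ) hbdd hnonconst]
      trivial
    exact Metric.mem_closure_iff.mp hmem _ hδ
  choose f hf hHf using happrox
  obtain ⟨E, hE, hfilter⟩ := exists_network_of_readouts (σ := τ) f hf
  refine ⟨E, hE, ?_, ?_⟩
  · refine continuous_pi fun t => ?_
    change Continuous fun z => E.filter hE z t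
    simp only [hfilter]
    have hd : Continuous (delay (-(t : ℤ)).toNat : BoundedSeq d M → BoundedSeq d M) :=
      (delayMap _).continuous
    fun_prop
  · refine lt_of_le_of_lt (iSup₂_le fun z t => ?_)
      ((ENNReal.ofReal_lt_ofReal_iff hε).mpr (half_lt_self hε))
    rw [← ofReal_norm]
    refine ENNReal.ofReal_le_ofReal ((euclidean_norm_le_sum _).trans ?_)
    have hU : U z t = U (delay (-(t : ℤ)).toNat z) NegTime.now := by
      rw [hti, delay, NegTime.now_back_toNat]
    calc ∑ j, |((U z t : EuclideanSpace ℝ (Fin m)) - E.filter hE z t).ofLp j|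
        ≤ ∑ _j : Fin m, ε / (2 * ((m : ℝ) + 1)) := by
          refine Finset.sum_le_sum fun j _ => ?_
          rw [hfilter, hU]
          exact (ContinuousMap.dist_apply_le_dist (f := H j) (g := f j) _).trans (hHf j).le
      _ = (m / (m + 1)) * (ε / 2) := by
          rw [Finset.sum_const, Finset.card_univ, Fintype.card_fin, nsmul_eq_mul]
          field_simp
      _ ≤ ε / 2 := mul_le_of_le_one_left (by positivity)
          ((div_le_one (by positivity)).mpr (by linarith))
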